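/- Let $I=\,]0,1]$, and let $\overline{\mathbb C}$ be the ring of Colombeau generalized complex numbers: nets $(x_\varepsilon)_{\varepsilon\in I}$ of complex numbers that are moderate ($|x_\varepsilon|/\varepsilon^{a}\to 0$ as $\varepsilon\to0$ for some $a\in\mathbb R$) modulo negligible ones ($|x_\varepsilon|/\varepsilon^{a}\to 0$ for every $a\in\mathbb R$). Equip it with the sharp topology, given by the ultrametric $D(x,y)=\|x-y\|$, where $\|x\|=e^{-V(x)}$ and $V(x)=\sup\{a\in\mathbb R : |x_\varepsilon|/\varepsilon^{a}\to0\}$. Let $\Omega\subseteq\mathbb C$ be a non-empty open set, and let $\mathcal G(\Omega;\mathbb C)$ be the (simplified) Colombeau algebra: nets $(f_\varepsilon)_{\varepsilon\in I}$ of functions in $\mathcal C^\infty(\Omega;\mathbb C)$ such that for every compact $K\subset\Omega$ and every (real) partial derivative $\partial^\alpha$ one has $\sup_K|\partial^\alpha f_\varepsilon|=O(\varepsilon^{a})$ for some $a\in\mathbb R$, modulo those nets for which this holds for every $a\in\mathbb R$. Let $\widetilde\Omega_c\subseteq\overline{\mathbb C}$ be the set of compactly supported generalized points, i.e. of the classes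 of moderate nets $(z_\varepsilon)$ that stay in a fixed compact subset of $\Omega$ for all small $\varepsilon$; for $f\in\mathcal G(\Omega;\mathbb C)$ and $z\in\widetilde\Omega_c$ the point value $f(z)\in\overline{\mathbb C}$ is the class of $(f_\varepsilon(z_\varepsilon))$. Let $f\in\mathcal G(\Omega;\mathbb C)$ be generalized holomorphic, i.e. $\overline\partial f=0$ in $\mathcal G(\Omega;\mathbb C)$, and let $f^{(n)}$ denote its $n$-th complex derivative $\partial^n f$, where $\partial=\frac12(\partial_x-i\partial_y)$. Suppose that $f$ satisfies the Identity Theorem, i.e. for every $z_0\in\widetilde\Omega_c$ the pre-image $f^{-1}(f(z_0))=\{z\in\widetilde\Omega_c : f(z)=f(z_0)\}$ has no accumulation point in $\widetilde\Omega_c$ with respect to the sharp topology. Then for every $z_0\in\widetilde\Omega_c$ the ideal $$C_f(z_0)=\langle f^{(n)}(z_0) \mid n\ge 1\rangle$$ of $\overline{\mathbb C}$ is dense, i.e. for all $r_1,r_2\in\overline{\mathbb C}$ with $r_1\neq0$ there is $r\in\overline{\mathbb C}$ with $r_1r\neq0$ and $r_2r\in C_f(z_0)$; and it is essential, i.e.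 $C_f(z_0)\cap L\neq(0)$ for every non-zero ideal $L$ of $\overline{\mathbb C}$. -/

import Mathlib

open Filter Topology Asymptotics
open scoped ContDiff

noncomputable section

namespace Colombeau

/-- The parameter set `I = ]0,1]`. -/
abbrev Param : Type := Set.Ioc (0 : ℝ) 1

/-- The filter on `I` of the limit `ε → 0`. -/
def eps : Filter Param := comap (fun ε : Param => (ε : ℝ)) (𝓝 0)

/-- The net `ε ↦ ε ^ a`, for a real number `a`. -/
def pw (a : ℝ) : Param → ℝ := fun ε => (ε : ℝ) ^ a

instance eps_neBot : eps.NeBot := by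
  unfold eps
  rw [comap_neBot_iff]
  intro t ht
  obtain ⟨r, hr, hrt⟩ := Metric.mem_nhds_iff.1 ht
  refine ⟨⟨min (r / 2) 1, by positivity, min_le_right _ _⟩, hrt ?_⟩
  have h1 : min (r / 2) 1 ≤ r / 2 := min_le_left _ _
  have h2 : 0 < min (r / 2) 1 := by positivity
  simp only [Metric.mem_ball, Real.dist_eq, sub_zero]
  rw [abs_of_pos h2]
  linarith

lemma pw_pos (a : ℝ) (ε : Param) : 0 < pw a ε := Real.rpow_pos_of_pos ε.2.1 a

lemma pw_add (a b : ℝ) (ε : Param) : pw (a + b) ε = pw a ε * pw b ε :=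
  Real.rpow_add ε.2.1 a b

lemma pw_zero (ε : Param) : pw 0 ε = 1 := Real.rpow_zero _

lemma pw_le {a b : ℝ} (h : a ≤ b) (ε : Param) : pw b ε ≤ pw a ε :=
  Real.rpow_le_rpow_of_exponent_ge ε.2.1 ε.2.2 h

lemma pw_isBigO {a b : ℝ} (h : a ≤ b) (l : Filter Param) : pw b =O[l] pw a :=
  IsBigO.of_bound 1 (Eventually.of_forall fun ε => by
    rw [Real.norm_of_nonneg (pw_pos b ε).le, Real.norm_of_nonneg (pw_pos a ε).le, one_mul]
    exact pw_le h ε)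

lemma tendsto_pw {a : ℝ} (h : 0 < a) : Tendsto (pw a) eps (𝓝 0) := by
  have h1 : Tendsto (fun x : ℝ => x ^ a) (𝓝 0) (𝓝 0) := by
    have := (Real.continuousAt_rpow_const 0 a (Or.inr h.le)).tendsto
    rwa [Real.zero_rpow h.ne'] at this
  exact h1.comp tendsto_comap

lemma pw_isLittleO {a b : ℝ} (h : a < b) : pw b =o[eps] pw a := by
  have h1 : pw (b - a) =o[eps] (fun _ => (1 : ℝ)) :=
    (isLittleO_one_iff ℝ).2 (tendsto_pw (sub_pos.2 h))
  have h2 := h1.mul_isBigO (isBigO_refl (pw a) eps)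
  refine (h2.congr_left fun ε => ?_).congr_right fun ε => ?_
  · rw [← pw_add]; congr 1; ring
  · simp

/-! ### Generalized numbers -/

/-- The net `x` satisfies `|x(ε)| / ε ^ a → 0` as `ε → 0`. -/
def Decays (x : Param → ℂ) (a : ℝ) : Prop := x =o[eps] pw a

lemma Decays.mono {x : Param → ℂ} {a b : ℝ} (h : Decays x b) (hab : a ≤ b) : Decays x a :=
  IsLittleO.trans_isBigO h (pw_isBigO hab _)

lemma Decays.mul {x y : Param → ℂ} {a b : ℝ} (hx : Decays x a) (hy : Decays y b) :
    Decays (x * y) (a + b) :=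
  (IsLittleO.mul hx hy).congr_right fun ε => (pw_add a b ε).symm

lemma decays_const (c : ℂ) : Decays (fun _ => c) (-1) := by
  have h : pw 0 =o[eps] pw (-1) := pw_isLittleO (by norm_num)
  refine IsBigO.trans_isLittleO ?_ h
  refine (isBigO_const_const c (one_ne_zero : (1 : ℝ) ≠ 0) eps).congr_right fun ε => ?_
  exact (pw_zero ε).symm

/-- Moderate nets of complex numbers. -/
def Moderate : Subalgebra ℂ (Param → ℂ) where
  carrier := {x | ∃ a : ℝ, Decays x a}
  mul_mem' := by
    rintro x y ⟨a, ha⟩ ⟨b, hb⟩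
    exact ⟨a + b, ha.mul hb⟩
  add_mem' := by
    rintro x y ⟨a, ha⟩ ⟨b, hb⟩
    exact ⟨min a b, IsLittleO.add (ha.mono (min_le_left _ _)) (hb.mono (min_le_right _ _))⟩
  algebraMap_mem' := fun c => ⟨-1, decays_const c⟩

/-- Negligible nets: moderate nets `x` with `|x(ε)| / ε ^ a → 0` for every real `a`. -/
def Negligible : Ideal Moderate where
  carrier := {x | ∀ a : ℝ, Decays x.1 a}
  zero_mem' := fun a => isLittleO_zero _ _
  add_mem' := fun hx hy a => IsLittleO.add (hx a) (hy a)
  smul_mem' := by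
    rintro ⟨c, b, hb⟩ x hx a
    have h := hb.mul (hx (a - b))
    rwa [add_sub_cancel] at h

/-- The ring of Colombeau generalized complex numbers: moderate nets modulo negligible nets. -/
def GenNum : Type := Moderate ⧸ Negligible

instance : CommRing GenNum := inferInstanceAs (CommRing (Moderate ⧸ Negligible))
instance : Algebra ℂ GenNum := inferInstanceAs (Algebra ℂ (Moderate ⧸ Negligible))

/-- The class of a moderate net. -/
def GenNum.mk : Moderate →+* GenNum := Ideal.Quotient.mk Negligible

lemma GenNum.mk_surjective : Function.Surjective GenNum.mk := Ideal.Quotient.mk_surjective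

lemma GenNum.mk_eq_mk {x y : Moderate} :
    GenNum.mk x = GenNum.mk y ↔ ∀ a : ℝ, Decays (x.1 - y.1) a :=
  Ideal.Quotient.eq

/-- The set `A(x)` of all real `a` such that `|x̂(ε)| / ε ^ a → 0` for a representative `x̂` of `x`
(equivalently for every one, see `mem_A_mk`). -/
def GenNum.A (x : GenNum) : Set ℝ := {a | ∃ y : Moderate, GenNum.mk y = x ∧ Decays y.1 a}

lemma GenNum.mem_A_mk {x : Moderate} {a : ℝ} : a ∈ (GenNum.mk x).A ↔ Decays x.1 a := by
  constructor
  · rintro ⟨y, hy, h⟩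
    have h1 := GenNum.mk_eq_mk.1 hy.symm a
    have h2 := IsLittleO.add h1 h
    simpa [Decays] using h2
  · exact fun h => ⟨x, rfl, h⟩

/-- The valuation `V(x) = sup A(x)`, in the extended reals. -/
def GenNum.V (x : GenNum) : EReal := ⨆ a ∈ x.A, (a : EReal)

/-- The sharp norm `‖x‖ = exp (-V(x))`, where `exp (-∞) = 0`. -/
def GenNum.sharpNorm (x : GenNum) : ℝ := (EReal.exp (-x.V)).toReal

lemma GenNum.coe_le_V {x : GenNum} {a : ℝ} (h : a ∈ x.A) : (a : EReal) ≤ x.V :=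
  le_iSup₂ (f := fun (a : ℝ) (_ : a ∈ x.A) => (a : EReal)) a h

lemma GenNum.mem_A_of_lt_V {x : GenNum} {a : ℝ} (h : (a : EReal) < x.V) : a ∈ x.A := by
  obtain ⟨b, hb, hab⟩ : ∃ b ∈ x.A, (a : EReal) < (b : EReal) := by
    simpa [GenNum.V, lt_iSup_iff] using h
  obtain ⟨y, hy, hd⟩ := hb
  exact ⟨y, hy, hd.mono (EReal.coe_lt_coe_iff.1 hab).le⟩

lemma GenNum.bot_lt_V (x : GenNum) : ⊥ < x.V := by
  obtain ⟨y, rfl⟩ := GenNum.mk_surjective x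
  obtain ⟨a, ha⟩ := y.2
  exact lt_of_lt_of_le (EReal.bot_lt_coe a) (GenNum.coe_le_V (GenNum.mem_A_mk.2 ha))

lemma GenNum.V_eq_top_iff {x : GenNum} : x.V = ⊤ ↔ x = 0 := by
  obtain ⟨y, rfl⟩ := GenNum.mk_surjective x
  have key : GenNum.mk y = 0 ↔ ∀ a : ℝ, Decays y.1 a := by
    rw [← map_zero GenNum.mk, GenNum.mk_eq_mk]
    simp
  rw [key]
  constructor
  · intro h a
    exact GenNum.mem_A_mk.1 (GenNum.mem_A_of_lt_V (h ▸ EReal.coe_lt_top a))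
  · intro h
    rw [EReal.eq_top_iff_forall_lt]
    intro a
    refine lt_of_lt_of_le ?_ (GenNum.coe_le_V (GenNum.mem_A_mk.2 (h (a + 1))))
    exact EReal.coe_lt_coe_iff.2 (by linarith)

lemma GenNum.A_neg (x : GenNum) : (-x).A = x.A := by
  obtain ⟨y, rfl⟩ := GenNum.mk_surjective x
  ext a
  rw [← map_neg, GenNum.mem_A_mk, GenNum.mem_A_mk]
  exact isLittleO_neg_left

lemma GenNum.V_add (x y : GenNum) : min x.V y.V ≤ (x + y).V := by
  refine EReal.ge_of_forall_gt_iff_ge.1 fun a ha => ?_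
  obtain ⟨x, rfl⟩ := GenNum.mk_surjective x
  obtain ⟨y, rfl⟩ := GenNum.mk_surjective y
  have h1 := GenNum.mem_A_mk.1 (GenNum.mem_A_of_lt_V (ha.trans_le (min_le_left _ _)))
  have h2 := GenNum.mem_A_mk.1 (GenNum.mem_A_of_lt_V (ha.trans_le (min_le_right _ _)))
  refine GenNum.coe_le_V ?_
  rw [← map_add, GenNum.mem_A_mk]
  exact IsLittleO.add h1 h2

lemma GenNum.exp_neg_V_ne_top (x : GenNum) : EReal.exp (-x.V) ≠ ⊤ := by
  intro h
  rw [EReal.exp_eq_top_iff, EReal.neg_eq_top_iff] at h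
  exact (GenNum.bot_lt_V x).ne' h

lemma GenNum.sharpNorm_eq_zero {x : GenNum} : x.sharpNorm = 0 ↔ x = 0 := by
  rw [GenNum.sharpNorm, ENNReal.toReal_eq_zero_iff, or_iff_left (GenNum.exp_neg_V_ne_top x),
    EReal.exp_eq_zero_iff, EReal.neg_eq_bot_iff, GenNum.V_eq_top_iff]

lemma GenNum.sharpNorm_nonneg (x : GenNum) : 0 ≤ x.sharpNorm := ENNReal.toReal_nonneg

lemma GenNum.sharpNorm_neg (x : GenNum) : (-x).sharpNorm = x.sharpNorm := by
  rw [GenNum.sharpNorm, GenNum.sharpNorm, GenNum.V, GenNum.V, GenNum.A_neg]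

lemma GenNum.sharpNorm_add_le_max (x y : GenNum) :
    (x + y).sharpNorm ≤ max x.sharpNorm y.sharpNorm := by
  unfold GenNum.sharpNorm
  rw [← ENNReal.toReal_max (GenNum.exp_neg_V_ne_top x) (GenNum.exp_neg_V_ne_top y)]
  refine ENNReal.toReal_mono ?_ ?_
  · exact (max_lt (GenNum.exp_neg_V_ne_top x).lt_top (GenNum.exp_neg_V_ne_top y).lt_top).ne
  · rcases min_le_iff.1 (GenNum.V_add x y) with h | h
    · exact le_max_of_le_left (EReal.exp_monotone (EReal.neg_le_neg_iff.2 h))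
    · exact le_max_of_le_right (EReal.exp_monotone (EReal.neg_le_neg_iff.2 h))

/-- The sharp ultrametric `D(x, y) = ‖x - y‖` on the generalized numbers. -/
instance : MetricSpace GenNum where
  dist x y := (x - y).sharpNorm
  dist_self x := by simp [GenNum.sharpNorm_eq_zero]
  dist_comm x y := by rw [← GenNum.sharpNorm_neg, neg_sub]
  dist_triangle x y z := by
    have h := GenNum.sharpNorm_add_le_max (x - y) (y - z)
    rw [sub_add_sub_cancel] at h
    exact h.trans (max_le_add_of_nonneg (GenNum.sharpNorm_nonneg _) (GenNum.sharpNorm_nonneg _))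
  eq_of_dist_eq_zero {x y} h := sub_eq_zero.1 (GenNum.sharpNorm_eq_zero.1 h)

/-! ### Generalized functions -/

/-- The net of functions `f` satisfies `sup_{z ∈ K} ‖Dⁿ f_ε (z)‖ = O(ε ^ a)` as `ε → 0`, where `Dⁿ`
is the total real derivative of order `n` (it carries all the partial derivatives of order `n`). -/
def UniformO (f : Param → ℂ → ℂ) (K : Set ℂ) (n : ℕ) (a : ℝ) : Prop :=
  ∃ C : ℝ, ∀ᶠ ε in eps, ∀ z ∈ K, ‖iteratedFDeriv ℝ n (f ε) z‖ ≤ C * (ε : ℝ) ^ a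

lemma UniformO.mono {f : Param → ℂ → ℂ} {K : Set ℂ} {n : ℕ} {a b : ℝ}
    (h : UniformO f K n b) (hab : a ≤ b) : UniformO f K n a := by
  obtain ⟨C, hC⟩ := h
  refine ⟨max C 0, hC.mono fun ε hε z hz => (hε z hz).trans ?_⟩
  exact mul_le_mul (le_max_left _ _) (pw_le hab ε) (pw_pos b ε).le (le_max_right _ _)

variable {Ω : TopologicalSpace.Opens ℂ}

lemma UniformO.add {f g : Param → ℂ → ℂ} {K : Set ℂ} {n : ℕ} {a : ℝ}
    (hfs : ∀ ε, ContDiffOn ℝ ∞ (f ε) Ω) (hgs : ∀ ε, ContDiffOn ℝ ∞ (g ε) Ω) (hK : K ⊆ Ω)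
    (hf : UniformO f K n a) (hg : UniformO g K n a) : UniformO (f + g) K n a := by
  obtain ⟨C, hC⟩ := hf
  obtain ⟨D, hD⟩ := hg
  refine ⟨C + D, (hC.and hD).mono fun ε hε z hz => ?_⟩
  have hz' := Ω.isOpen.mem_nhds (hK hz)
  have h1 : ContDiffAt ℝ n (f ε) z :=
    ((hfs ε).contDiffAt hz').of_le (by exact_mod_cast le_top)
  have h2 : ContDiffAt ℝ n (g ε) z :=
    ((hgs ε).contDiffAt hz').of_le (by exact_mod_cast le_top)
  rw [Pi.add_apply, iteratedFDeriv_add_apply h1 h2, add_mul]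
  exact (norm_add_le _ _).trans (add_le_add (hε.1 z hz) (hε.2 z hz))

lemma UniformO.mul {f g : Param → ℂ → ℂ} {K : Set ℂ} {n : ℕ} {a b : ℝ}
    (hfs : ∀ ε, ContDiffOn ℝ ∞ (f ε) Ω) (hgs : ∀ ε, ContDiffOn ℝ ∞ (g ε) Ω) (hK : K ⊆ Ω)
    (hf : ∀ m ≤ n, UniformO f K m a) (hg : ∀ m ≤ n, UniformO g K m b) :
    UniformO (f * g) K n (a + b) := by
  choose! C hC using hf
  choose! D hD using hg
  refine ⟨∑ i ∈ Finset.range (n + 1), (n.choose i : ℝ) * (C i * D (n - i)), ?_⟩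
  have hC' := (Set.finite_Iic n).eventually_all.2 hC
  have hD' := (Set.finite_Iic n).eventually_all.2 hD
  filter_upwards [hC', hD'] with ε h1 h2 z hz
  have hz' := Ω.isOpen.mem_nhds (hK hz)
  have hU : UniqueDiffOn ℝ (Ω : Set ℂ) := Ω.isOpen.uniqueDiffOn
  have hle : (n : WithTop ℕ∞) ≤ ∞ := by exact_mod_cast le_top
  have h3 := norm_iteratedFDerivWithin_mul_le (hfs ε) (hgs ε) hU (hK hz) hle
  have e : ∀ (m : ℕ) (u : ℂ → ℂ),
      iteratedFDerivWithin ℝ m u Ω z = iteratedFDeriv ℝ m u z := fun m u =>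
    iteratedFDerivWithin_of_isOpen m Ω.isOpen (hK hz)
  simp only [e] at h3
  refine h3.trans ?_
  rw [Finset.sum_mul]
  refine Finset.sum_le_sum fun i hi => ?_
  have hi' : i ≤ n := Nat.lt_succ_iff.1 (Finset.mem_range.1 hi)
  have k1 := h1 i hi' z hz
  have k2 := h2 (n - i) (Nat.sub_le _ _) z hz
  have k3 := mul_le_mul k1 k2 (norm_nonneg _) ((norm_nonneg _).trans k1)
  rw [Real.rpow_add ε.2.1]
  calc _ = (n.choose i : ℝ) * (‖iteratedFDeriv ℝ i (f ε) z‖ *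
        ‖iteratedFDeriv ℝ (n - i) (g ε) z‖) := by ring
    _ ≤ (n.choose i : ℝ) * (C i * (ε : ℝ) ^ a * (D (n - i) * (ε : ℝ) ^ b)) := by gcongr
    _ = _ := by ring

lemma UniformO.exists_le {f : Param → ℂ → ℂ} {K : Set ℂ}
    (hf : ∀ n, ∃ a, UniformO f K n a) (n : ℕ) : ∃ a, ∀ m ≤ n, UniformO f K m a := by
  choose a ha using hf
  refine ⟨(Finset.range (n + 1)).inf' ⟨0, by simp⟩ a, fun m hm => (ha m).mono ?_⟩
  exact Finset.inf'_le _ (Finset.mem_range.2 (Nat.lt_succ_iff.2 hm))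

lemma uniformO_const (c : ℂ) (K : Set ℂ) (n : ℕ) : UniformO (fun _ _ => c) K n 0 := by
  refine ⟨‖c‖, Eventually.of_forall fun ε z _ => ?_⟩
  rw [Real.rpow_zero, mul_one]
  rcases Nat.eq_zero_or_pos n with rfl | h
  · simp
  · rw [iteratedFDeriv_const_of_ne h.ne']
    simp

variable (Ω) in
/-- Moderate nets of smooth functions on `Ω`. The values outside `Ω` are irrelevant: they do not
occur in the estimates and disappear in the quotient below. -/
def ModerateFun : Subalgebra ℂ (Param → ℂ → ℂ) where
  carrier := {f | (∀ ε, ContDiffOn ℝ ∞ (f ε) Ω) ∧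
    ∀ K : Set ℂ, IsCompact K → K ⊆ Ω → ∀ n : ℕ, ∃ a : ℝ, UniformO f K n a}
  mul_mem' := by
    rintro f g ⟨hfs, hf⟩ ⟨hgs, hg⟩
    refine ⟨fun ε => (hfs ε).mul (hgs ε), fun K hK hKΩ n => ?_⟩
    obtain ⟨a, ha⟩ := UniformO.exists_le (hf K hK hKΩ) n
    obtain ⟨b, hb⟩ := UniformO.exists_le (hg K hK hKΩ) n
    exact ⟨a + b, UniformO.mul hfs hgs hKΩ ha hb⟩
  add_mem' := by
    rintro f g ⟨hfs, hf⟩ ⟨hgs, hg⟩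
    refine ⟨fun ε => (hfs ε).add (hgs ε), fun K hK hKΩ n => ?_⟩
    obtain ⟨a, ha⟩ := hf K hK hKΩ n
    obtain ⟨b, hb⟩ := hg K hK hKΩ n
    exact ⟨min a b, UniformO.add hfs hgs hKΩ (ha.mono (min_le_left _ _))
      (hb.mono (min_le_right _ _))⟩
  algebraMap_mem' := fun c => ⟨fun _ => contDiffOn_const, fun K _ _ n => ⟨0, uniformO_const c K n⟩⟩

variable (Ω) in
/-- Negligible nets of smooth functions on `Ω`. -/
def NegligibleFun : Ideal (ModerateFun Ω) where
  carrier := {f | ∀ K : Set ℂ, IsCompact K → K ⊆ Ω → ∀ (n : ℕ) (a : ℝ), UniformO f.1 K n a}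
  zero_mem' := fun K _ _ n a => by
    refine ⟨0, Eventually.of_forall fun ε z _ => ?_⟩
    have e : ((0 : ModerateFun Ω).1 ε) = (0 : ℂ → ℂ) := rfl
    rw [e]
    simp
  add_mem' := fun {f g} hf hg K hK hKΩ n a =>
    UniformO.add f.2.1 g.2.1 hKΩ (hf K hK hKΩ n a) (hg K hK hKΩ n a)
  smul_mem' := by
    intro c f hf K hK hKΩ n a
    obtain ⟨b, hb⟩ := UniformO.exists_le (c.2.2 K hK hKΩ) n
    have h := UniformO.mul c.2.1 f.2.1 hKΩ hb (fun m _ => hf K hK hKΩ m (a - b))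
    rwa [add_sub_cancel] at h

variable (Ω) in
/-- The (simplified) Colombeau algebra `𝒢(Ω; ℂ)` of generalized functions on `Ω`. -/
def GenFun : Type := ModerateFun Ω ⧸ NegligibleFun Ω

instance : CommRing (GenFun Ω) := inferInstanceAs (CommRing (ModerateFun Ω ⧸ NegligibleFun Ω))
instance : Algebra ℂ (GenFun Ω) := inferInstanceAs (Algebra ℂ (ModerateFun Ω ⧸ NegligibleFun Ω))

/-- The class of a moderate net of smooth functions. -/
def GenFun.mk : ModerateFun Ω →ₐ[ℂ] GenFun Ω := Ideal.Quotient.mkₐ ℂ (NegligibleFun Ω)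

/-! ### Derivatives of generalized functions -/

lemma norm_iteratedFDeriv_dir_le {u : ℂ → ℂ} (hu : ContDiffOn ℝ ∞ u Ω) (v : ℂ) (n : ℕ) {z : ℂ}
    (hz : z ∈ Ω) : ‖iteratedFDeriv ℝ n (fun w => fderiv ℝ u w v) z‖ ≤
      ‖v‖ * ‖iteratedFDeriv ℝ (n + 1) u z‖ := by
  have h1 : ContDiffAt ℝ ∞ (fderiv ℝ u) z :=
    (hu.contDiffAt (Ω.isOpen.mem_nhds hz)).fderiv_right (m := ∞) (by simp)
  have h2 := norm_iteratedFDeriv_clm_apply_const (c := v) (n := n) h1 (by exact_mod_cast le_top)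
  rwa [norm_iteratedFDeriv_fderiv] at h2

lemma contDiffOn_dir {u : ℂ → ℂ} (hu : ContDiffOn ℝ ∞ u Ω) (v : ℂ) :
    ContDiffOn ℝ ∞ (fun w => fderiv ℝ u w v) Ω :=
  (hu.fderiv_of_isOpen Ω.isOpen (m := ∞) (by simp)).clm_apply contDiffOn_const

lemma UniformO.dir {f : Param → ℂ → ℂ} {K : Set ℂ} {n : ℕ} {a : ℝ}
    (hfs : ∀ ε, ContDiffOn ℝ ∞ (f ε) Ω) (hK : K ⊆ Ω) (hf : UniformO f K (n + 1) a) (v : ℂ) :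
    UniformO (fun ε w => fderiv ℝ (f ε) w v) K n a := by
  obtain ⟨C, hC⟩ := hf
  refine ⟨‖v‖ * C, hC.mono fun ε hε z hz => ?_⟩
  refine (norm_iteratedFDeriv_dir_le (hfs ε) v n (hK hz)).trans ?_
  rw [mul_assoc]
  exact mul_le_mul_of_nonneg_left (hε z hz) (norm_nonneg v)

/-- The directional derivative, in the real direction `v`, of a moderate net of functions. -/
def dirNet (v : ℂ) (f : ModerateFun Ω) : ModerateFun Ω :=
  ⟨fun ε w => fderiv ℝ (f.1 ε) w v, fun ε => contDiffOn_dir (f.2.1 ε) v, fun K hK hKΩ n =>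
    (f.2.2 K hK hKΩ (n + 1)).imp fun _ ha => ha.dir f.2.1 hKΩ v⟩

/-- The directional derivative of a generalized function, in the real direction `v`: the class of
`ε ↦ D_v f_ε`. -/
def GenFun.dir (v : ℂ) (f : GenFun Ω) : GenFun Ω :=
  Quotient.liftOn' f (fun g => GenFun.mk (dirNet v g)) (by
    intro g h hgh
    have h0 : g - h ∈ NegligibleFun Ω := (Submodule.quotientRel_def _).1 hgh
    refine Ideal.Quotient.eq.2 ?_
    intro K hK hKΩ n a
    obtain ⟨C, hC⟩ := UniformO.dir (g - h).2.1 hKΩ (h0 K hK hKΩ (n + 1) a) v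
    refine ⟨C, hC.mono fun ε hε z hz => ?_⟩
    refine le_of_eq_of_le ?_ (hε z hz)
    congr 1
    refine Filter.EventuallyEq.eq_of_nhds (Filter.EventuallyEq.iteratedFDeriv ℝ ?_ n)
    filter_upwards [Ω.isOpen.mem_nhds (hKΩ hz)] with w hw
    have hg := ((g.2.1 ε).contDiffAt (Ω.isOpen.mem_nhds hw)).differentiableAt (by simp)
    have hh := ((h.2.1 ε).contDiffAt (Ω.isOpen.mem_nhds hw)).differentiableAt (by simp)
    have e : (g - h).1 ε = g.1 ε - h.1 ε := rfl
    rw [e, fderiv_sub hg hh]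
    rfl)

/-- The operator `∂̄ = (∂ₓ + i ∂ᵧ) / 2` on generalized functions. -/
def GenFun.dbar (f : GenFun Ω) : GenFun Ω :=
  (1 / 2 : ℂ) • (f.dir 1 + Complex.I • f.dir Complex.I)

/-- The operator `∂ = (∂ₓ - i ∂ᵧ) / 2` on generalized functions: the complex derivative `f'` of a
generalized holomorphic function `f`. -/
def GenFun.del (f : GenFun Ω) : GenFun Ω :=
  (1 / 2 : ℂ) • (f.dir 1 - Complex.I • f.dir Complex.I)

/-- Generalized holomorphic functions: `∂̄ f = 0` in the Colombeau algebra. -/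
def GenFun.IsHolomorphic (f : GenFun Ω) : Prop := f.dbar = 0

/-! ### Compactly supported generalized points and point values -/

variable (Ω) in
/-- The net `x` stays, for all small `ε`, in a fixed compact subset of `Ω`. -/
def CompactNet (x : Param → ℂ) : Prop :=
  ∃ K : Set ℂ, IsCompact K ∧ K ⊆ Ω ∧ ∀ᶠ ε in eps, x ε ∈ K

variable (Ω) in
/-- The set of compactly supported generalized points of `Ω`, with the sharp topology. -/
abbrev CompactPoint : Type := {z : GenNum // ∃ x : Moderate, GenNum.mk x = z ∧ CompactNet Ω x.1}

/-- A representative, eventually in a compact subset of `Ω`, of a compactly supported point. -/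
def CompactPoint.rep (z : CompactPoint Ω) : Moderate := z.2.choose

lemma CompactPoint.mk_rep (z : CompactPoint Ω) : GenNum.mk z.rep = z.1 := z.2.choose_spec.1

lemma CompactPoint.compactNet_rep (z : CompactPoint Ω) : CompactNet Ω z.rep.1 :=
  z.2.choose_spec.2

lemma decays_of_le {x : Param → ℂ} {a C : ℝ} (h : ∀ᶠ ε in eps, ‖x ε‖ ≤ C * (ε : ℝ) ^ a) :
    Decays x (a - 1) := by
  have h1 : x =O[eps] pw a := IsBigO.of_bound C (h.mono fun ε hε => by
    rwa [Real.norm_of_nonneg (pw_pos a ε).le])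
  exact h1.trans_isLittleO (pw_isLittleO (by linarith))

/-- The net of values `ε ↦ f_ε(x_ε)`. -/
def evalNet (f : ModerateFun Ω) (x : Param → ℂ) (hx : CompactNet Ω x) : Moderate :=
  ⟨fun ε => f.1 ε (x ε), by
    obtain ⟨K, hK, hKΩ, h⟩ := hx
    obtain ⟨a, C, hC⟩ := f.2.2 K hK hKΩ 0
    refine ⟨a - 1, decays_of_le (C := C) ?_⟩
    filter_upwards [h, hC] with ε h1 h2
    simpa using h2 (x ε) h1⟩

/-- The point value `f(z)` of a generalized function at a compactly supported generalized point,
the class of `ε ↦ f_ε(z_ε)`. It does not depend on the representatives, see `eval_mk`. -/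
def GenFun.eval (f : GenFun Ω) (z : CompactPoint Ω) : GenNum :=
  Quotient.liftOn' f (fun g => GenNum.mk (evalNet g z.rep.1 z.compactNet_rep)) (by
    intro g h hgh
    have h0 : g - h ∈ NegligibleFun Ω := (Submodule.quotientRel_def _).1 hgh
    refine GenNum.mk_eq_mk.2 fun a => ?_
    obtain ⟨K, hK, hKΩ, hz⟩ := z.compactNet_rep
    obtain ⟨C, hC⟩ := h0 K hK hKΩ 0 (a + 1)
    have h1 : Decays ((evalNet g z.rep.1 z.compactNet_rep).1 -
        (evalNet h z.rep.1 z.compactNet_rep).1) (a + 1 - 1) := by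
      refine decays_of_le (C := C) ?_
      filter_upwards [hz, hC] with ε h1 h2
      have h3 := h2 _ h1
      rw [norm_iteratedFDeriv_zero] at h3
      exact h3
    simpa using h1)

/-- Point values do not depend on the choice of the representatives. -/
lemma GenFun.eval_mk (f : ModerateFun Ω) (z : CompactPoint Ω) (x : Moderate)
    (hxz : GenNum.mk x = z.1) (hx : CompactNet Ω x.1) :
    (GenFun.mk f).eval z = GenNum.mk (evalNet f x.1 hx) := by
  change GenNum.mk (evalNet f z.rep.1 z.compactNet_rep) = _
  refine GenNum.mk_eq_mk.2 fun b => ?_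
  have hd := GenNum.mk_eq_mk.1 (z.mk_rep.trans hxz.symm)
  obtain ⟨K, hK, hKΩ, hxK⟩ := hx
  obtain ⟨δ, hδ, hδΩ⟩ := hK.exists_cthickening_subset_open Ω.isOpen hKΩ
  obtain ⟨a, C, hC⟩ := f.2.2 _ hK.cthickening hδΩ 1
  have hsmall : ∀ᶠ ε in eps, ‖(z.rep.1 - x.1) ε‖ ≤ δ := by
    have h := IsLittleO.def (hd 0) hδ
    filter_upwards [h] with ε hε
    rwa [pw_zero, norm_one, mul_one] at hε
  have hle : (fun ε => f.1 ε (z.rep.1 ε) - f.1 ε (x.1 ε)) =O[eps]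
      fun ε => pw a ε * ‖(z.rep.1 - x.1) ε‖ := by
    refine IsBigO.of_bound C ?_
    filter_upwards [hxK, hC, hsmall] with ε h1 h2 h3
    have hball : Metric.closedBall (x.1 ε) δ ⊆ Metric.cthickening δ K :=
      Metric.closedBall_subset_cthickening h1 δ
    have h4 : ∀ w ∈ Metric.closedBall (x.1 ε) δ, DifferentiableAt ℝ (f.1 ε) w := fun w hw =>
      ((f.2.1 ε).contDiffAt (Ω.isOpen.mem_nhds (hδΩ (hball hw)))).differentiableAt (by simp)
    have h5 : ∀ w ∈ Metric.closedBall (x.1 ε) δ, ‖fderiv ℝ (f.1 ε) w‖ ≤ C * (ε : ℝ) ^ a :=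
      fun w hw => by
        rw [← norm_iteratedFDeriv_one]
        exact h2 w (hball hw)
    have h6 := (convex_closedBall (x.1 ε) δ).norm_image_sub_le_of_norm_fderiv_le h4 h5
      (Metric.mem_closedBall_self hδ.le)
      (show z.rep.1 ε ∈ _ by rw [mem_closedBall_iff_norm]; exact h3)
    refine h6.trans (le_of_eq ?_)
    rw [norm_mul, Real.norm_of_nonneg (pw_pos a ε).le, norm_norm, mul_assoc]
    rfl
  refine hle.trans_isLittleO ?_
  have h7 := (isBigO_refl (pw a) eps).mul_isLittleO (hd (b - a)).norm_left
  refine h7.congr_right fun ε => ?_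
  rw [← pw_add, add_sub_cancel]

/-! ### The Identity Theorem and the coefficient ideal -/

/-- `f` satisfies the Identity Theorem: for each compactly supported point `z₀`, the pre-image
`f⁻¹(f(z₀))` has no accumulation point (in the sharp topology). -/
def GenFun.SatisfiesIdentityTheorem (f : GenFun Ω) : Prop :=
  ∀ z₀ : CompactPoint Ω, ∀ w : CompactPoint Ω, ¬ AccPt w (𝓟 (f.eval ⁻¹' {f.eval z₀}))

/-- The ideal `C_f(z₀)` generated by the values `f⁽ⁿ⁾(z₀)`, `n ≥ 1`. -/
def GenFun.coeffIdeal (f : GenFun Ω) (z₀ : CompactPoint Ω) : Ideal GenNum :=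
  Ideal.span {c | ∃ n : ℕ, 1 ≤ n ∧ c = (GenFun.del^[n] f).eval z₀}

/-- A dense ideal, in the algebraic sense used for maximal rings of quotients: for all `r₁ ≠ 0` and
`r₂` there is an `r` with `r₁ r ≠ 0` and `r₂ r ∈ J`. -/
def IsDenseIdeal {R : Type*} [CommRing R] (J : Ideal R) : Prop :=
  ∀ r₁ r₂ : R, r₁ ≠ 0 → ∃ r : R, r₁ * r ≠ 0 ∧ r₂ * r ∈ J

/-- An essential ideal: it meets every nonzero ideal in a nonzero ideal. -/
def IsEssentialIdeal {R : Type*} [CommRing R] (J : Ideal R) : Prop :=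
  ∀ L : Ideal R, L ≠ ⊥ → J ⊓ L ≠ ⊥

end Colombeau

end

/-!
The argument reduces both claims to one fact: no `r ≠ 0` annihilates all the derivatives
`f⁽ⁿ⁾(z₀)`, `n ≥ 1`. Given this, some `c ∈ C_f(z₀)` has `r c ≠ 0`. Density follows because
`r₂ c ∈ C_f(z₀)`, and essentiality because `r c` lies in `C_f(z₀)` and in every ideal containing `r`.

Suppose that `r ≠ 0` annihilates all the derivatives. Then `|r_ε| ≥ ε ^ a` for the `ε` in some set
`S` that accumulates at `0`, so all the derivatives of order `n ≥ 1` are negligible at `z₀` along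
`S`. By Taylor expansion, `f` is then constant along `S`, up to a negligible error, on discs about
`z₀` of radii `ε ^ b`, for every `b > 0` (`localO_sub_center_of_forall`). Hence the points that equal
`z₀ + ε ^ b` for `ε ∈ S` and `z₀` for the other `ε` have the same value as `z₀`. They are distinct
from `z₀` and converge to it as `b → ∞`, contrary to the Identity Theorem
(`accPt_of_mul_eval_eq_zero`).

The expansion needs the remainder of order `N` to gain a factor `ε ^ (b N)` without losing it to the
growth of the `N`-th derivative. What makes this work is that on a compact set all the derivatives
are bounded by the same power of `ε` (`exists_uniformO_iterate`). For holomorphic functions this is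
Cauchy's estimate; the representatives here only have negligible `∂̄f_ε`, so `norm_wirt_le` proves a
version of the estimate for smooth functions, with error terms in `∂̄`. It follows from an approximate
mean value property on circles and an integration by parts in the angle. The Taylor expansion
itself is replaced by repeated use of the mean value inequality, from the derivative of order `N`
down to the function.
-/

open Filter Topology Asymptotics
open scoped ContDiff

noncomputable section

namespace Colombeau

variable {Ω : TopologicalSpace.Opens ℂ}

/-! ### A Cauchy estimate for smooth functions -/

/-- The Wirtinger derivative `∂u = (∂ₓu - i ∂ᵧu) / 2` of a function of the real variables. -/
def wirt (u : ℂ → ℂ) (z : ℂ) : ℂ :=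
  (1 / 2 : ℂ) * (fderiv ℝ u z 1 - Complex.I * fderiv ℝ u z Complex.I)

/-- The Wirtinger derivative `∂̄u = (∂ₓu + i ∂ᵧu) / 2` of a function of the real variables. -/
def wirtBar (u : ℂ → ℂ) (z : ℂ) : ℂ :=
  (1 / 2 : ℂ) * (fderiv ℝ u z 1 + Complex.I * fderiv ℝ u z Complex.I)

lemma fderiv_apply_eq_wirt (u : ℂ → ℂ) (z v : ℂ) :
    fderiv ℝ u z v = v * wirt u z + (starRingEnd ℂ) v * wirtBar u z := by
  have h : v = v.re • (1 : ℂ) + v.im • Complex.I := by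
    rw [Complex.real_smul, Complex.real_smul, mul_one, Complex.re_add_im]
  have h1 : fderiv ℝ u z v = v.re * fderiv ℝ u z 1 + v.im * fderiv ℝ u z Complex.I := by
    conv_lhs => rw [h]
    rw [map_add, map_smul, map_smul, Complex.real_smul, Complex.real_smul]
  have h2 : (starRingEnd ℂ) v = v.re - v.im * Complex.I := by
    apply Complex.ext <;> simp
  rw [h1, h2]
  have h3 : v = v.re + v.im * Complex.I := (Complex.re_add_im v).symm
  unfold wirt wirtBar
  linear_combination ((v.im : ℂ) * fderiv ℝ u z Complex.I) * Complex.I_sq -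
    (1 / 2 * (fderiv ℝ u z 1 - Complex.I * fderiv ℝ u z Complex.I)) * h3

lemma norm_fderiv_le_wirt (u : ℂ → ℂ) (z : ℂ) :
    ‖fderiv ℝ u z‖ ≤ ‖wirt u z‖ + ‖wirtBar u z‖ := by
  refine ContinuousLinearMap.opNorm_le_bound _ (by positivity) fun v => ?_
  rw [fderiv_apply_eq_wirt]
  refine (norm_add_le _ _).trans (le_of_eq ?_)
  rw [norm_mul, norm_mul, RCLike.norm_conj]
  ring

lemma contDiffOn_wirt {u : ℂ → ℂ} (hu : ContDiffOn ℝ ∞ u Ω) : ContDiffOn ℝ ∞ (wirt u) Ω :=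
  contDiffOn_const.mul ((contDiffOn_dir hu 1).sub (contDiffOn_const.mul (contDiffOn_dir hu _)))

lemma differentiableAt_of_contDiffOn {u : ℂ → ℂ} (hu : ContDiffOn ℝ ∞ u Ω) {z : ℂ} (hz : z ∈ Ω) :
    DifferentiableAt ℝ u z :=
  (hu.contDiffAt (Ω.isOpen.mem_nhds hz)).differentiableAt (by simp)

lemma fderiv_dir_comm {u : ℂ → ℂ} (hu : ContDiffOn ℝ ∞ u Ω) (v w : ℂ) {z : ℂ} (hz : z ∈ Ω) :
    fderiv ℝ (fun y => fderiv ℝ u y v) z w = fderiv ℝ (fun y => fderiv ℝ u y w) z v := by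
  have h1 : ContDiffAt ℝ ∞ u z := hu.contDiffAt (Ω.isOpen.mem_nhds hz)
  have h2 : DifferentiableAt ℝ (fderiv ℝ u) z :=
    (h1.fderiv_right (m := ∞) (by simp)).differentiableAt (by simp)
  have h3 : IsSymmSndFDerivAt ℝ u z := h1.isSymmSndFDerivAt (by simpa using ENat.LEInfty.out)
  rw [fderiv_clm_apply h2 (differentiableAt_const v), fderiv_clm_apply h2 (differentiableAt_const w)]
  simpa using h3 w v

/-- The operators `∂` and `∂̄` commute, by the symmetry of the second derivative. -/
lemma wirtBar_wirt {u : ℂ → ℂ} (hu : ContDiffOn ℝ ∞ u Ω) {z : ℂ} (hz : z ∈ Ω) :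
    wirtBar (wirt u) z = wirt (wirtBar u) z := by
  have d : ∀ v, DifferentiableAt ℝ (fun y => fderiv ℝ u y v) z := fun v =>
    differentiableAt_of_contDiffOn (contDiffOn_dir hu v) hz
  have e1 : fderiv ℝ (wirt u) z = (1 / 2 : ℂ) • (fderiv ℝ (fun y => fderiv ℝ u y 1) z -
      Complex.I • fderiv ℝ (fun y => fderiv ℝ u y Complex.I) z) :=
    (((d 1).hasFDerivAt.sub ((d Complex.I).hasFDerivAt.const_mul Complex.I)).const_mul _).fderiv
  have e2 : fderiv ℝ (wirtBar u) z = (1 / 2 : ℂ) • (fderiv ℝ (fun y => fderiv ℝ u y 1) z +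
      Complex.I • fderiv ℝ (fun y => fderiv ℝ u y Complex.I) z) :=
    (((d 1).hasFDerivAt.add ((d Complex.I).hasFDerivAt.const_mul Complex.I)).const_mul _).fderiv
  rw [wirtBar, wirt, e1, e2]
  simp only [_root_.smul_apply, _root_.sub_apply, _root_.add_apply, smul_eq_mul]
  rw [fderiv_dir_comm hu 1 Complex.I hz]
  ring

/-- The point `e^{iθ}` of the unit circle. -/
def circ (θ : ℝ) : ℂ := Complex.exp (θ * Complex.I)

lemma norm_circ (θ : ℝ) : ‖circ θ‖ = 1 := Complex.norm_exp_ofReal_mul_I θ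

lemma hasDerivAt_circ (θ : ℝ) : HasDerivAt circ (circ θ * Complex.I) θ := by
  have h1 : HasDerivAt (fun t : ℝ => (t : ℂ) * Complex.I) Complex.I θ := by
    simpa using (Complex.ofRealCLM.hasDerivAt (x := θ)).mul_const Complex.I
  exact h1.cexp

lemma continuous_circ : Continuous circ := by unfold circ; fun_prop

lemma circ_two_pi : circ (2 * Real.pi) = circ 0 := by
  simp [circ, Complex.exp_two_pi_mul_I]

lemma circ_mul_conj (θ : ℝ) : circ θ * (starRingEnd ℂ) (circ θ) = 1 := by
  rw [Complex.mul_conj, Complex.normSq_eq_norm_sq, norm_circ]; simp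

lemma hasDerivAt_comp_circle {u : ℂ → ℂ} {p : ℂ} {s θ : ℝ}
    (hu : DifferentiableAt ℝ u (p + s * circ θ)) :
    HasDerivAt (fun t : ℝ => u (p + s * circ t))
      (fderiv ℝ u (p + s * circ θ) (s * (circ θ * Complex.I))) θ :=
  hu.hasFDerivAt.comp_hasDerivAt θ (((hasDerivAt_circ θ).const_mul (s : ℂ)).const_add p)

/-- A function that is close to the derivative of a `2π`-periodic function has a small integral
over the period. -/
lemma norm_integral_le_of_near_deriv {F F' g : ℝ → ℂ} {M : ℝ}
    (hF : ∀ θ, HasDerivAt F (F' θ) θ) (hF' : Continuous F') (hg : Continuous g)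
    (hper : F (2 * Real.pi) = F 0) (h : ∀ θ, ‖g θ - F' θ‖ ≤ M) :
    ‖∫ θ in (0 : ℝ)..(2 * Real.pi), g θ‖ ≤ M * (2 * Real.pi) := by
  have h1 : ∫ θ in (0 : ℝ)..(2 * Real.pi), F' θ = 0 := by
    rw [intervalIntegral.integral_eq_sub_of_hasDerivAt (fun θ _ => hF θ)
      (hF'.intervalIntegrable _ _), hper, sub_self]
  have h2 := intervalIntegral.integral_sub (hg.intervalIntegrable (μ := MeasureTheory.volume) 0
    (2 * Real.pi)) (hF'.intervalIntegrable 0 (2 * Real.pi))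
  rw [h1, sub_zero] at h2
  rw [← h2]
  have h3 := intervalIntegral.norm_integral_le_of_norm_le_const (a := 0) (b := 2 * Real.pi)
    (fun θ _ => h θ)
  rwa [sub_zero, abs_of_pos Real.two_pi_pos] at h3

lemma circle_mem {p : ℂ} {r s : ℝ} (h0 : 0 ≤ s) (hs : s ≤ r) (θ : ℝ) :
    p + s * circ θ ∈ Metric.closedBall p r := by
  rw [mem_closedBall_iff_norm, add_sub_cancel_left, norm_mul, norm_circ, mul_one,
    Complex.norm_real, Real.norm_of_nonneg h0]
  exact hs

/-- The integral over a circle of the outward derivative is controlled by `∂̄u`: up to a term in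
`∂̄u`, the radial derivative is a multiple of the angular one, whose integral vanishes. -/
lemma norm_integral_radial_le {u : ℂ → ℂ} (hu : ContDiffOn ℝ ∞ u Ω) {p : ℂ} {s B : ℝ} (hs : 0 < s)
    (hp : Metric.closedBall p s ⊆ Ω) (hB : ∀ z ∈ Metric.closedBall p s, ‖wirtBar u z‖ ≤ B) :
    ‖∫ θ in (0 : ℝ)..(2 * Real.pi), fderiv ℝ u (p + s * circ θ) (circ θ)‖
      ≤ 2 * B * (2 * Real.pi) := by
  have hm : ∀ θ, p + s * circ θ ∈ Metric.closedBall p s := circle_mem hs.le le_rfl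
  have hc : Continuous fun θ => fderiv ℝ u (p + s * circ θ) :=
    (hu.continuousOn_fderiv_of_isOpen Ω.isOpen (by simp)).comp_continuous
      (by have := continuous_circ; fun_prop) fun θ => hp (hm θ)
  have hk := continuous_circ
  have hs' : (s : ℂ) ≠ 0 := by exact_mod_cast hs.ne'
  refine norm_integral_le_of_near_deriv
    (F := fun θ : ℝ => (s * Complex.I)⁻¹ * u (p + s * circ θ))
    (fun θ => (hasDerivAt_comp_circle (differentiableAt_of_contDiffOn hu (hp (hm θ)))).const_mul _)
    (by fun_prop) (by fun_prop) (by simp only [circ_two_pi]) fun θ => ?_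
  have e : fderiv ℝ u (p + s * circ θ) (circ θ) - (s * Complex.I)⁻¹ *
      fderiv ℝ u (p + s * circ θ) (s * (circ θ * Complex.I)) =
      2 * (starRingEnd ℂ) (circ θ) * wirtBar u (p + s * circ θ) := by
    rw [fderiv_apply_eq_wirt, fderiv_apply_eq_wirt]
    simp only [map_mul, Complex.conj_I, Complex.conj_ofReal]
    field_simp
    ring
  rw [e, norm_mul, norm_mul, RCLike.norm_conj, norm_circ, mul_one]
  simpa using hB _ (hm θ)

/-- An approximate mean value property: the deviation of the mean of `v` over a circle from the
value at the centre is controlled by `∂̄v`. -/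
lemma norm_integral_circle_sub_le {v : ℂ → ℂ} (hv : ContDiffOn ℝ ∞ v Ω) {p : ℂ} {r B : ℝ}
    (hr : 0 < r) (hp : Metric.closedBall p r ⊆ Ω)
    (hB : ∀ z ∈ Metric.closedBall p r, ‖wirtBar v z‖ ≤ B) :
    ‖∫ θ in (0 : ℝ)..(2 * Real.pi), (v (p + r * circ θ) - v p)‖
      ≤ 2 * B * (2 * Real.pi) * r := by
  have hk := continuous_circ
  let G : ℝ → ℝ → ℂ := fun s θ => fderiv ℝ v (p + s * circ θ) (circ θ)
  have hG : ContinuousOn (Function.uncurry G) (Set.Icc 0 r ×ˢ Set.univ) := by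
    have h1 : ContinuousOn (fun x : ℝ × ℝ => fderiv ℝ v (p + x.1 * circ x.2))
        (Set.Icc 0 r ×ˢ Set.univ) :=
      (hv.continuousOn_fderiv_of_isOpen Ω.isOpen (by simp)).comp (by fun_prop)
        fun x hx => hp (circle_mem hx.1.1 hx.1.2 x.2)
    exact h1.clm_apply (by fun_prop)
  have hradial : ∀ θ : ℝ, ∫ s in (0 : ℝ)..r, G s θ = v (p + r * circ θ) - v p := fun θ => by
    have h1 : ∀ s ∈ Set.uIcc 0 r, HasDerivAt (fun t : ℝ => v (p + t * circ θ)) (G s θ) s := by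
      intro s hs
      rw [Set.uIcc_of_le hr.le] at hs
      have h2 : HasDerivAt (fun t : ℝ => p + t * circ θ) (circ θ) s := by
        simpa using ((Complex.ofRealCLM.hasDerivAt (x := s)).mul_const (circ θ)).const_add p
      exact (differentiableAt_of_contDiffOn hv
        (hp (circle_mem hs.1 hs.2 θ))).hasFDerivAt.comp_hasDerivAt s h2
    have h3 : ContinuousOn (fun s => G s θ) (Set.uIcc 0 r) := by
      rw [Set.uIcc_of_le hr.le]
      exact hG.comp (f := fun s : ℝ => (s, θ)) (by fun_prop) fun s hs => ⟨hs, trivial⟩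
    rw [intervalIntegral.integral_eq_sub_of_hasDerivAt h1 h3.intervalIntegrable]
    simp
  have hswap : ∫ s in (0 : ℝ)..r, ∫ θ in (0 : ℝ)..(2 * Real.pi), G s θ =
      ∫ θ in (0 : ℝ)..(2 * Real.pi), ∫ s in (0 : ℝ)..r, G s θ := by
    simp only [intervalIntegral.integral_of_le Real.two_pi_pos.le]
    refine MeasureTheory.intervalIntegral_integral_swap ?_
    rw [MeasureTheory.Measure.prod_restrict, Set.uIoc_of_le hr.le]
    have h1 : MeasureTheory.IntegrableOn (Function.uncurry G)
        (Set.Icc 0 r ×ˢ Set.Icc 0 (2 * Real.pi)) (MeasureTheory.volume.prod MeasureTheory.volume) :=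
      (hG.mono (Set.prod_mono le_rfl (Set.subset_univ _))).integrableOn_compact
        (isCompact_Icc.prod isCompact_Icc)
    exact h1.mono_set (Set.prod_mono Set.Ioc_subset_Icc_self Set.Ioc_subset_Icc_self)
  simp only [hradial] at hswap
  rw [← hswap]
  have h4 := intervalIntegral.norm_integral_le_of_norm_le_const (a := 0) (b := r)
    (C := 2 * B * (2 * Real.pi))
    (f := fun s => ∫ θ in (0 : ℝ)..(2 * Real.pi), G s θ) fun s hs => by
      rw [Set.uIoc_of_le hr.le] at hs
      have hsub : Metric.closedBall p s ⊆ Metric.closedBall p r :=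
        Metric.closedBall_subset_closedBall hs.2
      exact norm_integral_radial_le hv hs.1 (hsub.trans hp) fun z hz => hB z (hsub hz)
  rwa [sub_zero, abs_of_pos hr] at h4

/-- The integral of `∂u` over a circle is controlled by `u` and `∂̄u`: integrate by parts against
`e^{-iθ}`. -/
lemma norm_integral_wirt_le {u : ℂ → ℂ} (hu : ContDiffOn ℝ ∞ u Ω) {p : ℂ} {r A B : ℝ}
    (hr : 0 < r) (hp : Metric.closedBall p r ⊆ Ω)
    (hA : ∀ z ∈ Metric.closedBall p r, ‖u z‖ ≤ A)
    (hB : ∀ z ∈ Metric.closedBall p r, ‖wirtBar u z‖ ≤ B) :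
    ‖∫ θ in (0 : ℝ)..(2 * Real.pi), wirt u (p + r * circ θ)‖
      ≤ (A / r + B) * (2 * Real.pi) := by
  have hk := continuous_circ
  have hm : ∀ θ, p + r * circ θ ∈ Metric.closedBall p r := circle_mem hr.le le_rfl
  have hcu : Continuous fun θ => u (p + r * circ θ) :=
    hu.continuousOn.comp_continuous (by fun_prop) fun θ => hp (hm θ)
  have hcw : Continuous fun θ => wirt u (p + r * circ θ) :=
    (contDiffOn_wirt hu).continuousOn.comp_continuous (by fun_prop) fun θ => hp (hm θ)
  have hc : Continuous fun θ => fderiv ℝ u (p + r * circ θ) :=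
    (hu.continuousOn_fderiv_of_isOpen Ω.isOpen (by simp)).comp_continuous
      (by fun_prop) fun θ => hp (hm θ)
  have hr' : (r : ℂ) ≠ 0 := by exact_mod_cast hr.ne'
  have hconj : ∀ θ, HasDerivAt (fun t => (starRingEnd ℂ) (circ t))
      ((starRingEnd ℂ) (circ θ * Complex.I)) θ := fun θ =>
    Complex.conjCLE.toContinuousLinearMap.hasFDerivAt.comp_hasDerivAt θ (hasDerivAt_circ θ)
  have hconjc : Continuous fun t => (starRingEnd ℂ) (circ t) := Complex.continuous_conj.comp hk
  have hconjc' : Continuous fun t => (starRingEnd ℂ) (circ t * Complex.I) :=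
    Complex.continuous_conj.comp (by fun_prop)
  refine norm_integral_le_of_near_deriv
    (F := fun θ : ℝ => (r * Complex.I)⁻¹ * ((starRingEnd ℂ) (circ θ) * u (p + r * circ θ)))
    (fun θ => ((hconj θ).mul (hasDerivAt_comp_circle
      (differentiableAt_of_contDiffOn hu (hp (hm θ))))).const_mul _)
    (continuous_const.mul ((hconjc'.mul hcu).add (hconjc.mul (by fun_prop)))) hcw
    (by simp only [circ_two_pi]) fun θ => ?_
  have e : wirt u (p + r * circ θ) - (r * Complex.I)⁻¹ *
      ((starRingEnd ℂ) (circ θ * Complex.I) * u (p + r * circ θ) +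
        (starRingEnd ℂ) (circ θ) * fderiv ℝ u (p + r * circ θ) (r * (circ θ * Complex.I))) =
      (starRingEnd ℂ) (circ θ) * u (p + r * circ θ) / r +
      (starRingEnd ℂ) (circ θ) ^ 2 * wirtBar u (p + r * circ θ) := by
    rw [fderiv_apply_eq_wirt]
    simp only [map_mul, Complex.conj_I, Complex.conj_ofReal]
    have h := circ_mul_conj θ
    field_simp
    linear_combination (-wirt u (p + r * circ θ) * r) * h
  rw [e]
  refine (norm_add_le _ _).trans ?_
  rw [norm_mul, norm_div, norm_mul, norm_pow, RCLike.norm_conj, norm_circ, Complex.norm_real,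
    Real.norm_of_nonneg hr.le]
  simp only [one_mul, one_pow]
  gcongr
  · exact hA _ (hm θ)
  · exact hB _ (hm θ)

/-- Cauchy's estimate for the first derivative, with error terms in `∂̄u`. -/
lemma norm_wirt_le {u : ℂ → ℂ} (hu : ContDiffOn ℝ ∞ u Ω) {p : ℂ} {r A B D : ℝ}
    (hr : 0 < r) (hp : Metric.closedBall p r ⊆ Ω)
    (hA : ∀ z ∈ Metric.closedBall p r, ‖u z‖ ≤ A)
    (hB : ∀ z ∈ Metric.closedBall p r, ‖wirtBar u z‖ ≤ B)
    (hD : ∀ z ∈ Metric.closedBall p r, ‖wirtBar (wirt u) z‖ ≤ D) :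
    ‖wirt u p‖ ≤ A / r + B + 2 * D * r := by
  have h1 := norm_integral_wirt_le hu hr hp hA hB
  have h2 := norm_integral_circle_sub_le (contDiffOn_wirt hu) hr hp hD
  have hcw : Continuous fun θ => wirt u (p + r * circ θ) :=
    (contDiffOn_wirt hu).continuousOn.comp_continuous (by have := continuous_circ; fun_prop)
      fun θ => hp (circle_mem hr.le le_rfl θ)
  rw [intervalIntegral.integral_sub (hcw.intervalIntegrable _ _)
    (continuous_const.intervalIntegrable _ _), intervalIntegral.integral_const, sub_zero] at h2
  have h3 : ‖(2 * Real.pi) • wirt u p‖ = ‖wirt u p‖ * (2 * Real.pi) := by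
    rw [norm_smul, Real.norm_of_nonneg Real.two_pi_pos.le, mul_comm]
  have h4 := norm_sub_norm_le ((2 * Real.pi) • wirt u p)
    (∫ θ in (0 : ℝ)..(2 * Real.pi), wirt u (p + r * circ θ))
  rw [norm_sub_rev, h3] at h4
  refine le_of_mul_le_mul_right ?_ Real.two_pi_pos
  linarith

/-! ### Generalized holomorphic nets -/

/-- The net `ε ↦ ∂f_ε`. -/
def delNet (f : ModerateFun Ω) : ModerateFun Ω :=
  (1 / 2 : ℂ) • (dirNet 1 f - Complex.I • dirNet Complex.I f)

/-- The net `ε ↦ ∂̄f_ε`. -/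
def dbarNet (f : ModerateFun Ω) : ModerateFun Ω :=
  (1 / 2 : ℂ) • (dirNet 1 f + Complex.I • dirNet Complex.I f)

lemma delNet_apply (f : ModerateFun Ω) (ε : Param) : (delNet f).1 ε = wirt (f.1 ε) := rfl

lemma dbarNet_apply (f : ModerateFun Ω) (ε : Param) : (dbarNet f).1 ε = wirtBar (f.1 ε) := rfl

lemma mk_delNet (f : ModerateFun Ω) : GenFun.mk (delNet f) = (GenFun.mk f).del := rfl

lemma mk_delNet_iterate (f : ModerateFun Ω) (n : ℕ) :
    GenFun.mk (delNet^[n] f) = GenFun.del^[n] (GenFun.mk f) :=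
  (Function.Semiconj.iterate_right (f := GenFun.mk) mk_delNet n) f

lemma isHolomorphic_mk {f : ModerateFun Ω} :
    (GenFun.mk f).IsHolomorphic ↔ dbarNet f ∈ NegligibleFun Ω :=
  Ideal.Quotient.eq_zero_iff_mem

lemma NegligibleFun.dirNet {f : ModerateFun Ω} (hf : f ∈ NegligibleFun Ω) (v : ℂ) :
    dirNet v f ∈ NegligibleFun Ω :=
  fun K hK hKΩ n a => (hf K hK hKΩ (n + 1) a).dir f.2.1 hKΩ v

lemma NegligibleFun.delNet {f : ModerateFun Ω} (hf : f ∈ NegligibleFun Ω) :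
    delNet f ∈ NegligibleFun Ω := by
  have h : ∀ (c : ℂ) {g : ModerateFun Ω}, g ∈ NegligibleFun Ω → c • g ∈ NegligibleFun Ω :=
    fun c g hg => by
      rw [Algebra.smul_def]
      exact Ideal.mul_mem_left _ _ hg
  exact h _ (Ideal.sub_mem _ (NegligibleFun.dirNet hf 1) (h _ (NegligibleFun.dirNet hf _)))

lemma NegligibleFun.congr {f g : ModerateFun Ω} (hf : f ∈ NegligibleFun Ω)
    (h : ∀ ε, ∀ z ∈ Ω, g.1 ε z = f.1 ε z) : g ∈ NegligibleFun Ω := by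
  intro K hK hKΩ n a
  obtain ⟨C, hC⟩ := hf K hK hKΩ n a
  refine ⟨C, hC.mono fun ε hε z hz => le_of_eq_of_le ?_ (hε z hz)⟩
  congr 1
  refine Filter.EventuallyEq.eq_of_nhds (Filter.EventuallyEq.iteratedFDeriv ℝ ?_ n)
  filter_upwards [Ω.isOpen.mem_nhds (hKΩ hz)] with w hw using h ε w hw

lemma dbarNet_delNet_mem {f : ModerateFun Ω} (hf : dbarNet f ∈ NegligibleFun Ω) :
    dbarNet (delNet f) ∈ NegligibleFun Ω :=
  NegligibleFun.congr (NegligibleFun.delNet hf) fun ε _ hz => wirtBar_wirt (f.2.1 ε) hz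

lemma dbarNet_iterate_mem {f : ModerateFun Ω} (hf : dbarNet f ∈ NegligibleFun Ω) (n : ℕ) :
    dbarNet (delNet^[n] f) ∈ NegligibleFun Ω := by
  induction n with
  | zero => exact hf
  | succ n ih => rw [Function.iterate_succ_apply']; exact dbarNet_delNet_mem ih

lemma UniformO.subset {f : Param → ℂ → ℂ} {K K' : Set ℂ} {n : ℕ} {a : ℝ} (h : UniformO f K n a)
    (hK : K' ⊆ K) : UniformO f K' n a :=
  h.imp fun _ hC => hC.mono fun _ hε z hz => hε z (hK hz)

/-- The derivative of a generalized holomorphic net is bounded on `K` by the same power of `ε` as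
the net itself is on a neighbourhood of `K`. -/
lemma UniformO.delNet {f : ModerateFun Ω} (hf : dbarNet f ∈ NegligibleFun Ω) {K : Set ℂ}
    (hK : IsCompact K) {δ : ℝ} (hδ : 0 < δ) (hKΩ : Metric.cthickening δ K ⊆ Ω) {a : ℝ}
    (h : UniformO f.1 (Metric.cthickening δ K) 0 a) : UniformO (delNet f).1 K 0 a := by
  obtain ⟨A, hA⟩ := h
  obtain ⟨B, hB⟩ := hf _ hK.cthickening hKΩ 0 a
  obtain ⟨D, hD⟩ := dbarNet_delNet_mem hf _ hK.cthickening hKΩ 0 a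
  refine ⟨A / δ + B + 2 * D * δ, ?_⟩
  filter_upwards [hA, hB, hD] with ε hA hB hD z hz
  simp only [norm_iteratedFDeriv_zero, dbarNet_apply, delNet_apply] at hA hB hD ⊢
  have hsub := Metric.closedBall_subset_cthickening hz δ
  refine (norm_wirt_le (f.2.1 ε) hδ (hsub.trans hKΩ) (fun w hw => hA w (hsub hw))
    (fun w hw => hB w (hsub hw)) fun w hw => hD w (hsub hw)).trans (le_of_eq ?_)
  ring

/-- On a compact set, all the derivatives of a generalized holomorphic net are bounded by one and
the same power of `ε`. -/
lemma exists_uniformO_iterate {f : ModerateFun Ω} (hf : dbarNet f ∈ NegligibleFun Ω) {K : Set ℂ}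
    (hK : IsCompact K) (hKΩ : K ⊆ Ω) : ∃ a, ∀ n, UniformO (delNet^[n] f).1 K 0 a := by
  obtain ⟨δ, hδ, hδΩ⟩ := hK.exists_cthickening_subset_open Ω.isOpen hKΩ
  obtain ⟨a, ha⟩ := f.2.2 _ hK.cthickening hδΩ 0
  -- Each differentiation costs a little of the neighbourhood, but nothing of the exponent.
  have key : ∀ n, ∀ η, 0 ≤ η → η < δ → UniformO (delNet^[n] f).1 (Metric.cthickening η K) 0 a := by
    intro n
    induction n with
    | zero => exact fun η _ h => ha.subset (Metric.cthickening_mono h.le K)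
    | succ n ih =>
      intro η h0 h
      obtain ⟨ξ, h1, h2⟩ := exists_between h
      have hsub : Metric.cthickening (ξ - η) (Metric.cthickening η K) ⊆ Metric.cthickening ξ K := by
        have := Metric.cthickening_cthickening_subset (sub_pos.2 h1).le h0 K
        rwa [sub_add_cancel] at this
      rw [Function.iterate_succ_apply']
      exact UniformO.delNet (dbarNet_iterate_mem hf n) hK.cthickening (sub_pos.2 h1)
        (hsub.trans ((Metric.cthickening_mono h2.le K).trans hδΩ))
        ((ih ξ (h0.trans h1.le) h2).subset hsub)
  exact ⟨a, fun n => (key n 0 le_rfl hδ).subset (Metric.self_subset_cthickening K)⟩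

/-! ### Vanishing of the derivatives along a set of parameters -/

/-- The net of functions `g` is `O(ε ^ c)`, uniformly on the discs of radii `ε ^ b` about the
points of the net `x`, as `ε → 0` in the set `S` of parameters. -/
def LocalO (g : Param → ℂ → ℂ) (x : Param → ℂ) (S : Set Param) (b c : ℝ) : Prop :=
  ∃ C : ℝ, 0 ≤ C ∧ ∀ᶠ ε in eps, ε ∈ S → ∀ w ∈ Metric.closedBall (x ε) (pw b ε),
    ‖g ε w‖ ≤ C * pw c ε

lemma LocalO.mono {g : Param → ℂ → ℂ} {x : Param → ℂ} {S : Set Param} {b c d : ℝ}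
    (h : LocalO g x S b d) (hcd : c ≤ d) : LocalO g x S b c := by
  obtain ⟨C, hC0, hC⟩ := h
  exact ⟨C, hC0, hC.mono fun ε hε hS w hw =>
    (hε hS w hw).trans (mul_le_mul_of_nonneg_left (pw_le hcd ε) hC0)⟩

/-- A generalized holomorphic net with derivative `O(ε ^ c)` on discs of radii `ε ^ b` varies by
`O(ε ^ (c + b))` there. -/
lemma LocalO.sub_center {f : ModerateFun Ω} (hf : dbarNet f ∈ NegligibleFun Ω) {x : Param → ℂ}
    {S : Set Param} {b c : ℝ} {K : Set ℂ} (hK : IsCompact K) (hKΩ : K ⊆ Ω)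
    (hx : ∀ᶠ ε in eps, Metric.closedBall (x ε) (pw b ε) ⊆ K)
    (h : LocalO (delNet f).1 x S b c) :
    LocalO (fun ε w => f.1 ε w - f.1 ε (x ε)) x S b (c + b) := by
  obtain ⟨C, hC0, hC⟩ := h
  obtain ⟨B, hB⟩ := hf K hK hKΩ 0 c
  refine ⟨C + max B 0, by positivity, ?_⟩
  filter_upwards [hx, hC, hB] with ε hx hC hB hS w hw
  have h1 : ∀ y ∈ Metric.closedBall (x ε) (pw b ε), DifferentiableAt ℝ (f.1 ε) y := fun y hy =>
    differentiableAt_of_contDiffOn (f.2.1 ε) (hKΩ (hx hy))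
  have h2 : ∀ y ∈ Metric.closedBall (x ε) (pw b ε),
      ‖fderiv ℝ (f.1 ε) y‖ ≤ (C + max B 0) * pw c ε := fun y hy => by
    have hB' := hB y (hx hy)
    rw [norm_iteratedFDeriv_zero] at hB'
    rw [add_mul]
    exact (norm_fderiv_le_wirt _ _).trans (add_le_add (hC hS y hy)
      (hB'.trans (mul_le_mul_of_nonneg_right (le_max_left _ _) (pw_pos c ε).le)))
  have h3 := (convex_closedBall (x ε) (pw b ε)).norm_image_sub_le_of_norm_fderiv_le h1 h2
    (Metric.mem_closedBall_self (pw_pos b ε).le) hw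
  refine h3.trans ?_
  rw [pw_add, ← mul_assoc]
  have := pw_pos c ε
  exact mul_le_mul_of_nonneg_left (mem_closedBall_iff_norm.1 hw) (by positivity)

/-- If all the derivatives of a generalized holomorphic net are negligible at the net `x` along the
set `S` of parameters, then the net is constant along `S`, up to a negligible error, on discs about
`x` of radii `ε ^ b`. -/
lemma localO_sub_center_of_forall {f : ModerateFun Ω} (hf : dbarNet f ∈ NegligibleFun Ω)
    {x : Param → ℂ} {S : Set Param} {b : ℝ} (hb : 0 < b) {K : Set ℂ} (hK : IsCompact K)
    (hKΩ : K ⊆ Ω) (hx : ∀ᶠ ε in eps, Metric.closedBall (x ε) (pw b ε) ⊆ K)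
    (h : ∀ n, 1 ≤ n → ∀ q, ∀ᶠ ε in eps, ε ∈ S → ‖(delNet^[n] f).1 ε (x ε)‖ ≤ pw q ε) (q : ℝ) :
    LocalO (fun ε w => f.1 ε w - f.1 ε (x ε)) x S b q := by
  obtain ⟨a, ha⟩ := exists_uniformO_iterate hf hK hKΩ
  -- A bound for one derivative gives one for the preceding derivative, better by a factor `ε ^ b`.
  have key : ∀ j : ℕ, ∀ n, 1 ≤ n → LocalO (delNet^[n] f).1 x S b (a + j * b) := by
    intro j
    induction j with
    | zero =>
      intro n _
      obtain ⟨C, hC⟩ := ha n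
      refine ⟨max C 0, le_max_right _ _, ?_⟩
      filter_upwards [hC, hx] with ε hC hx _ w hw
      have h1 := hC w (hx hw)
      rw [norm_iteratedFDeriv_zero] at h1
      rw [Nat.cast_zero, zero_mul, add_zero]
      exact h1.trans (mul_le_mul_of_nonneg_right (le_max_left _ _) (pw_pos a ε).le)
    | succ j ih =>
      intro n hn
      have h1 := ih (n + 1) (by omega)
      rw [Function.iterate_succ_apply'] at h1
      obtain ⟨C, hC0, hC⟩ := LocalO.sub_center (dbarNet_iterate_mem hf n) hK hKΩ hx h1
      refine ⟨C + 1, by positivity, ?_⟩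
      filter_upwards [hC, h n hn (a + j * b + b)] with ε hC h2 hS w hw
      have e : a + ((j + 1 : ℕ) : ℝ) * b = a + j * b + b := by push_cast; ring
      rw [e, add_mul, one_mul]
      have h3 := norm_add_le ((delNet^[n] f).1 ε w - (delNet^[n] f).1 ε (x ε))
        ((delNet^[n] f).1 ε (x ε))
      rw [sub_add_cancel] at h3
      exact h3.trans (add_le_add (hC hS w hw) (h2 hS))
  obtain ⟨j, hj⟩ := exists_nat_gt ((q - a) / b)
  rw [div_lt_iff₀ hb] at hj
  exact (LocalO.sub_center hf hK hKΩ hx (key j 1 le_rfl)).mono (by linarith)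

/-! ### Accumulation points of fibres -/

/-- The moderate net that is `ε ^ b` for `ε ∈ S` and zero for the other `ε`. -/
def bump (S : Set Param) (b : ℝ) : Moderate :=
  ⟨S.indicator fun ε => (pw b ε : ℂ), b - 1, decays_of_le (C := 1) (Eventually.of_forall fun ε =>
    (norm_indicator_le_norm_self _ _).trans (by
      rw [Complex.norm_real, Real.norm_of_nonneg (pw_pos b ε).le, one_mul]; rfl))⟩

lemma norm_bump_le (S : Set Param) (b : ℝ) (ε : Param) : ‖(bump S b).1 ε‖ ≤ pw b ε :=
  (norm_indicator_le_norm_self (s := S) (fun ε => (pw b ε : ℂ)) ε).trans (by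
    rw [Complex.norm_real, Real.norm_of_nonneg (pw_pos b ε).le])

lemma sharpNorm_le {x : GenNum} {a : ℝ} (h : a ∈ x.A) : x.sharpNorm ≤ Real.exp (-a) := by
  have h1 : EReal.exp (-x.V) ≤ ENNReal.ofReal (Real.exp (-a)) := by
    rw [← EReal.exp_coe, EReal.coe_neg]
    exact EReal.exp_monotone (EReal.neg_le_neg_iff.2 (GenNum.coe_le_V h))
  exact ENNReal.toReal_le_of_le_ofReal (Real.exp_pos _).le h1

lemma sharpNorm_mk_bump_le (S : Set Param) (b : ℝ) :
    (GenNum.mk (bump S b)).sharpNorm ≤ Real.exp (-(b - 1)) :=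
  sharpNorm_le (GenNum.mem_A_mk.2 (decays_of_le (C := 1) (Eventually.of_forall fun ε => by
    rw [one_mul]; exact norm_bump_le S b ε)))

lemma mk_bump_ne_zero {S : Set Param} (hS : ∃ᶠ ε in eps, ε ∈ S) (b : ℝ) :
    GenNum.mk (bump S b) ≠ 0 := by
  rw [← map_zero GenNum.mk, Ne, GenNum.mk_eq_mk]
  intro h
  have h1 := (h b).def (c := 1 / 2) (by norm_num)
  obtain ⟨ε, hε, h2⟩ := (hS.and_eventually h1).exists
  have e : ((bump S b).1 - (0 : Moderate).1) ε = (pw b ε : ℂ) := by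
    change S.indicator (fun ε => (pw b ε : ℂ)) ε - 0 = _
    rw [Set.indicator_of_mem hε, sub_zero]
  rw [e, Complex.norm_real, Real.norm_of_nonneg (pw_pos b ε).le] at h2
  linarith [pw_pos b ε]

/-- A non-zero generalized number is bounded below by a power of `ε` along some set of parameters
that accumulates at zero. -/
lemma exists_frequently_le {r : Moderate} (hr : GenNum.mk r ≠ 0) :
    ∃ a : ℝ, ∃ᶠ ε in eps, pw a ε ≤ ‖r.1 ε‖ := by
  by_contra! h
  refine hr ?_
  rw [← map_zero GenNum.mk, GenNum.mk_eq_mk]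
  intro a
  have h1 : Decays r.1 (a + 1 - 1) := decays_of_le (C := 1) ((h (a + 1)).mono fun ε hε => by
    rw [one_mul]; exact hε.le)
  rw [add_sub_cancel_right] at h1
  simpa using h1

/-- If a non-zero generalized number annihilates all the derivatives of a generalized holomorphic
function at `z₀`, then `z₀` is an accumulation point of the fibre through `z₀`. -/
lemma accPt_of_mul_eval_eq_zero {f : GenFun Ω} (hf : f.IsHolomorphic) (z₀ : CompactPoint Ω)
    {r : GenNum} (hr : r ≠ 0) (h : ∀ n, 1 ≤ n → r * (GenFun.del^[n] f).eval z₀ = 0) :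
    AccPt z₀ (𝓟 (f.eval ⁻¹' {f.eval z₀})) := by
  obtain ⟨F, rfl⟩ : ∃ F, GenFun.mk F = f := Ideal.Quotient.mk_surjective f
  obtain ⟨r, rfl⟩ := GenNum.mk_surjective r
  rw [isHolomorphic_mk] at hf
  obtain ⟨a, hS⟩ := exists_frequently_le hr
  set S : Set Param := {ε | pw a ε ≤ ‖r.1 ε‖}
  set x : Moderate := z₀.rep
  have hxc : CompactNet Ω x.1 := z₀.compactNet_rep
  have hder : ∀ n, 1 ≤ n → ∀ q, ∀ᶠ ε in eps, ε ∈ S →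
      ‖(delNet^[n] F).1 ε (x.1 ε)‖ ≤ pw q ε := by
    intro n hn q
    have h1 := h n hn
    rw [← mk_delNet_iterate, GenFun.eval_mk _ _ x z₀.mk_rep hxc, ← map_mul,
      ← map_zero GenNum.mk, GenNum.mk_eq_mk] at h1
    filter_upwards [(h1 (a + q)).def one_pos] with ε h2 hε
    have h3 : ‖r.1 ε‖ * ‖(delNet^[n] F).1 ε (x.1 ε)‖ ≤ pw a ε * pw q ε := by
      rw [← norm_mul, ← pw_add]
      rw [one_mul, Real.norm_of_nonneg (pw_pos _ ε).le] at h2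
      exact le_of_eq_of_le (congrArg norm (sub_zero _).symm) h2
    exact le_of_mul_le_mul_left
      ((mul_le_mul_of_nonneg_right hε (norm_nonneg _)).trans h3) (pw_pos a ε)
  obtain ⟨K, hK, hKΩ, hxK⟩ := hxc
  obtain ⟨δ, hδ, hδΩ⟩ := hK.exists_cthickening_subset_open Ω.isOpen hKΩ
  have hball : ∀ b : ℝ, 0 < b →
      ∀ᶠ ε in eps, Metric.closedBall (x.1 ε) (pw b ε) ⊆ Metric.cthickening δ K := fun b hb => by
    filter_upwards [hxK, (tendsto_pw hb).eventually (gt_mem_nhds hδ)] with ε h1 h2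
    exact (Metric.closedBall_subset_closedBall h2.le).trans
      (Metric.closedBall_subset_cthickening h1 δ)
  have hmem : ∀ (b : ℝ) (ε : Param),
      (x + bump S b).1 ε ∈ Metric.closedBall (x.1 ε) (pw b ε) := fun b ε => by
    rw [mem_closedBall_iff_norm]
    exact le_of_eq_of_le (congrArg norm (add_sub_cancel_left _ _)) (norm_bump_le S b ε)
  have hcomp : ∀ b : ℝ, 0 < b → CompactNet Ω (x + bump S b).1 := fun b hb =>
    ⟨_, hK.cthickening, hδΩ, (hball b hb).mono fun ε h => h (hmem b ε)⟩
  rw [accPt_iff_nhds]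
  intro U hU
  obtain ⟨η, hη, hηU⟩ := Metric.mem_nhds_iff.1 hU
  obtain ⟨b, hb0, hb⟩ : ∃ b : ℝ, 0 < b ∧ Real.exp (-(b - 1)) < η := by
    have h1 : Tendsto (fun b : ℝ => Real.exp (-(b - 1))) atTop (𝓝 0) :=
      Real.tendsto_exp_neg_atTop_nhds_zero.comp (tendsto_atTop_add_const_right _ (-1) tendsto_id)
    exact ((eventually_gt_atTop 0).and (h1.eventually (gt_mem_nhds hη))).exists
  let y : CompactPoint Ω := ⟨GenNum.mk (x + bump S b), x + bump S b, rfl, hcomp b hb0⟩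
  have hy : y.1 - z₀.1 = GenNum.mk (bump S b) := by
    rw [← z₀.mk_rep]
    change GenNum.mk (x + bump S b) - GenNum.mk x = _
    rw [map_add, add_sub_cancel_left]
  refine ⟨y, ⟨hηU ?_, ?_⟩, fun hyz => mk_bump_ne_zero (S := S) hS b ?_⟩
  · change (y.1 - z₀.1).sharpNorm < η
    rw [hy]
    exact (sharpNorm_mk_bump_le S b).trans_lt hb
  · change (GenFun.mk F).eval y = (GenFun.mk F).eval z₀
    rw [GenFun.eval_mk _ y _ rfl (hcomp b hb0), GenFun.eval_mk _ z₀ x z₀.mk_rep z₀.compactNet_rep,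
      GenNum.mk_eq_mk]
    intro q
    obtain ⟨C, hC0, hC⟩ := localO_sub_center_of_forall hf hb0 hK.cthickening hδΩ (hball b hb0)
      hder (q + 1)
    rw [← add_sub_cancel_right q 1]
    refine decays_of_le (C := C) (hC.mono fun ε hε => ?_)
    by_cases hεS : ε ∈ S
    · exact hε hεS _ (hmem b ε)
    · -- Outside `S` the two points agree.
      have e : (x + bump S b).1 ε = x.1 ε := by
        change x.1 ε + S.indicator (fun ε => (pw b ε : ℂ)) ε = _
        rw [Set.indicator_of_notMem hεS, add_zero]
      change ‖F.1 ε ((x + bump S b).1 ε) - F.1 ε (x.1 ε)‖ ≤ _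
      rw [e, sub_self, norm_zero]
      exact mul_nonneg hC0 (pw_pos (q + 1) ε).le
  · rw [← hy, hyz, sub_self]

/-- For a generalized holomorphic function satisfying the Identity Theorem, no non-zero
generalized number annihilates all the derivatives at a point. -/
lemma exists_mul_eval_ne_zero {f : GenFun Ω} (hf : f.IsHolomorphic)
    (hid : f.SatisfiesIdentityTheorem) (z₀ : CompactPoint Ω) {r : GenNum} (hr : r ≠ 0) :
    ∃ c ∈ f.coeffIdeal z₀, r * c ≠ 0 := by
  by_contra! h
  exact hid z₀ z₀ (accPt_of_mul_eval_eq_zero hf z₀ hr fun n hn =>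
    h _ (Ideal.subset_span ⟨n, hn, rfl⟩))

end Colombeau

end

theorem mainTheorem1 (Ω : TopologicalSpace.Opens ℂ) (hΩ : (Ω : Set ℂ).Nonempty)
    (f : Colombeau.GenFun Ω) (hf : f.IsHolomorphic) (hid : f.SatisfiesIdentityTheorem)
    (z₀ : Colombeau.CompactPoint Ω) :
    Colombeau.IsDenseIdeal (f.coeffIdeal z₀) ∧ Colombeau.IsEssentialIdeal (f.coeffIdeal z₀) := by
  constructor
  · intro r₁ r₂ hr
    obtain ⟨c, hc, hne⟩ := Colombeau.exists_mul_eval_ne_zero hf hid z₀ hr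
    exact ⟨c, hne, Ideal.mul_mem_left _ _ hc⟩
  · intro L hL hbot
    obtain ⟨r, hrL, hr⟩ := Submodule.exists_mem_ne_zero_of_ne_bot hL
    obtain ⟨c, hc, hne⟩ := Colombeau.exists_mul_eval_ne_zero hf hid z₀ hr
    have hmem : r * c ∈ f.coeffIdeal z₀ ⊓ L :=
      ⟨Ideal.mul_mem_left _ _ hc, Ideal.mul_mem_right _ _ hrL⟩
    rw [hbot] at hmem
    exact hne hmem
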